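/- Let $p$ be a prime and let $\mathbb{K}$ be a field of characteristic zero. For finite groups $H,G$, a finite $(H,G)$-biset is called $p$-bifree if the stabilizers in $H$ and the stabilizers in $G$ of all its elements are $p'$-groups (that is, of order prime to $p$). Let $B^\Delta(H,G)$ be the Grothendieck group of finite $p$-bifree $(H,G)$-bisets with respect to disjoint unions, and $\mathbb{K}B^\Delta(H,G)=\mathbb{K}\otimes_{\mathbb{Z}}B^\Delta(H,G)$. Let $\mathbb{K}\mathcal{C}^\Delta$ be the $\mathbb{K}$-linear category whose objects are the finite groups, with $\mathrm{Hom}(G,H)=\mathbb{K}B^\Delta(H,G)$ and composition $\cdot$ induced by $(X,Y)\mapsto X\times_H Y$. Write $1$ for the trivial group and regard $\mathbb{K}$ as the trivial module of $\mathbb{K}\mathrm{Out}(1)\cong E_1:=\mathbb{K}B^\Delta(1,1)$. The simple $p$-bifree biset functor $S^\Delta_{1,\mathbb{K}}:\mathbb{K}\mathcal{C}^\Delta\to{}_{\mathbb{K}}\mathrm{Mod}$ is the quotient $L_{1,\mathbb{K}}/J_{1,\mathbb{K}}$, where, for a finite group $G$, \[ L_{1,\mathbb{K}}(G)=\mathbb{K}B^\Delta(G,1)\otimes_{E_1}\mathbb{K},\qquad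 J_{1,\mathbb{K}}(G)=\Bigl\{\sum_i x_i\otimes v_i\in L_{1,\mathbb{K}}(G)\;\Big|\;\sum_i (y\cdot x_i)\,v_i=0\ \text{ for all } y\in\mathbb{K}B^\Delta(1,G)\Bigr\}. \] Then for every finite group $G$ the $\mathbb{K}$-vector space $S^\Delta_{1,\mathbb{K}}(G)$ is finite-dimensional, and $\dim_{\mathbb{K}}S^\Delta_{1,\mathbb{K}}(G)$ is equal to the number of $G$-conjugacy classes of cyclic $p'$-subgroups of $G$. -/

import Mathlib

open CategoryTheory MulOpposite
open scoped TensorProduct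

universe u v w

noncomputable section

namespace PBifree

/-- A group is a `p'`-group if its order is prime to `p` (only used for finite groups). -/
def IsPPrimeGroup (p : ℕ) (A : Type*) [Group A] : Prop :=
  (Nat.card A).Coprime p

/-- A finite `p`-bifree `(H, G)`-biset: a finite set with commuting left `H`-action and right
`G`-action (a right action is an action of `Gᵐᵒᵖ`) such that all left stabilizers
`{h | h • x = x}` and all right stabilizers `{g | x • g = x}` are `p'`-groups. -/
structure Biset (p : ℕ) (H G : Type u) [Group H] [Group G] where
  carrier : Type u
  [finite : Finite carrier]
  [left : MulAction H carrier]
  [right : MulAction Gᵐᵒᵖ carrier]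
  [comm : SMulCommClass H Gᵐᵒᵖ carrier]
  left_stabilizer (x : carrier) : IsPPrimeGroup p (MulAction.stabilizer H x)
  right_stabilizer (x : carrier) : IsPPrimeGroup p (MulAction.stabilizer Gᵐᵒᵖ x)

attribute [instance] Biset.finite Biset.left Biset.right Biset.comm

section Bisets

variable {p : ℕ} {K H G F : Type u} [Group K] [Group H] [Group G] [Group F]

/-- An isomorphism of `(H, G)`-bisets. -/
structure BisetIso (X Y : Biset p H G) extends X.carrier ≃ Y.carrier where
  map_left (h : H) (x : X.carrier) : toFun (h • x) = h • toFun x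
  map_right (g : Gᵐᵒᵖ) (x : X.carrier) : toFun (g • x) = g • toFun x

instance bisetSetoid (p : ℕ) (H G : Type u) [Group H] [Group G] : Setoid (Biset p H G) where
  r X Y := Nonempty (BisetIso X Y)
  iseqv :=
    { refl := fun X => ⟨⟨Equiv.refl _, fun _ _ => rfl, fun _ _ => rfl⟩⟩
      symm := by
        rintro X Y ⟨e⟩
        refine ⟨⟨e.toEquiv.symm, fun h y => ?_, fun g y => ?_⟩⟩
        · apply e.toEquiv.injective
          have := e.map_left h (e.toEquiv.symm y)
          simp_all
        · apply e.toEquiv.injective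
          have := e.map_right g (e.toEquiv.symm y)
          simp_all
      trans := by
        rintro X Y Z ⟨e⟩ ⟨f⟩
        refine ⟨⟨e.toEquiv.trans f.toEquiv, fun h y => ?_, fun g y => ?_⟩⟩
        · have h1 := e.map_left h y
          have h2 := f.map_left h (e.toEquiv y)
          simp_all
        · have h1 := e.map_right g y
          have h2 := f.map_right g (e.toEquiv y)
          simp_all }

/-- Isomorphism classes of `p`-bifree `(H, G)`-bisets. -/
def IsoClass (p : ℕ) (H G : Type u) [Group H] [Group G] : Type (u + 1) :=
  Quotient (bisetSetoid p H G)

/-! ### Disjoint union -/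

theorem stabilizer_inl {A X Y : Type*} [Group A] [MulAction A X] [MulAction A Y] (x : X) :
    MulAction.stabilizer A (Sum.inl x : X ⊕ Y) = MulAction.stabilizer A x := by
  ext a; simp [MulAction.mem_stabilizer_iff]

theorem stabilizer_inr {A X Y : Type*} [Group A] [MulAction A X] [MulAction A Y] (y : Y) :
    MulAction.stabilizer A (Sum.inr y : X ⊕ Y) = MulAction.stabilizer A y := by
  ext a; simp [MulAction.mem_stabilizer_iff]

/-- The disjoint union of two bisets. -/
def Biset.sum (X Y : Biset p H G) : Biset p H G where
  carrier := X.carrier ⊕ Y.carrier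
  left_stabilizer := by
    rintro (x | y)
    · rw [stabilizer_inl]; exact X.left_stabilizer x
    · rw [stabilizer_inr]; exact Y.left_stabilizer y
  right_stabilizer := by
    rintro (x | y)
    · rw [stabilizer_inl]; exact X.right_stabilizer x
    · rw [stabilizer_inr]; exact Y.right_stabilizer y

/-- The empty biset. -/
def Biset.empty (p : ℕ) (H G : Type u) [Group H] [Group G] : Biset p H G where
  carrier := PEmpty
  left := { smul := fun _ x => x, one_smul := fun _ => rfl, mul_smul := fun _ _ x => x.elim }
  right := { smul := fun _ x => x, one_smul := fun _ => rfl, mul_smul := fun _ _ x => x.elim }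
  comm := @SMulCommClass.mk _ _ _ ⟨fun _ x => x⟩ ⟨fun _ x => x⟩ fun _ _ x => x.elim
  left_stabilizer x := x.elim
  right_stabilizer x := x.elim

instance : Add (IsoClass p H G) where
  add := Quotient.map₂ Biset.sum (by
    rintro X X' ⟨e⟩ Y Y' ⟨f⟩
    refine ⟨⟨Equiv.sumCongr e.toEquiv f.toEquiv, ?_, ?_⟩⟩
    · rintro h (x | y)
      · exact congrArg Sum.inl (e.map_left h x)
      · exact congrArg Sum.inr (f.map_left h y)
    · rintro h (x | y)
      · exact congrArg Sum.inl (e.map_right h x)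
      · exact congrArg Sum.inr (f.map_right h y))

instance : Zero (IsoClass p H G) where
  zero := Quotient.mk _ (Biset.empty p H G)

theorem IsoClass.add_comm' (a b : IsoClass p H G) : a + b = b + a := by
  induction a using Quotient.inductionOn with | _ X
  induction b using Quotient.inductionOn with | _ Y
  refine Quotient.sound ⟨⟨Equiv.sumComm _ _, ?_, ?_⟩⟩ <;> rintro h (x | y) <;> rfl

theorem IsoClass.zero_add' (a : IsoClass p H G) : 0 + a = a := by
  induction a using Quotient.inductionOn with | _ X
  refine Quotient.sound ⟨⟨Equiv.emptySum PEmpty X.carrier, ?_, ?_⟩⟩ <;>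
    rintro h (x | y) <;> first | exact x.elim | rfl

instance : AddCommMonoid (IsoClass p H G) where
  add_assoc a b c := by
    induction a using Quotient.inductionOn with | _ X
    induction b using Quotient.inductionOn with | _ Y
    induction c using Quotient.inductionOn with | _ Z
    refine Quotient.sound ⟨⟨Equiv.sumAssoc _ _ _, ?_, ?_⟩⟩ <;> rintro h ((x | y) | z) <;> rfl
  zero_add := IsoClass.zero_add'
  add_zero a := by rw [IsoClass.add_comm', IsoClass.zero_add']
  add_comm := IsoClass.add_comm'
  nsmul := nsmulRec

/-! ### Composition of bisets -/

/-- The relation `(x h, y) ∼ (x, h y)` on `X × Y`. -/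
def compSetoid (X : Biset p K H) (Y : Biset p H G) : Setoid (X.carrier × Y.carrier) where
  r a b := ∃ h : H, b.1 = op h • a.1 ∧ a.2 = h • b.2
  iseqv :=
    { refl := fun a => ⟨1, by simp, by simp⟩
      symm := by
        rintro a b ⟨h, h1, h2⟩
        exact ⟨h⁻¹, by simp [h1], by simp [h2]⟩
      trans := by
        rintro a b c ⟨h, h1, h2⟩ ⟨k, k1, k2⟩
        exact ⟨h * k, by rw [k1, h1, op_mul, mul_smul], by rw [h2, k2, mul_smul]⟩ }

instance compLeft (X : Biset p K H) (Y : Biset p H G) :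
    MulAction K (Quotient (compSetoid X Y)) where
  smul k := Quotient.map (fun a => (k • a.1, a.2)) (by
    rintro a b ⟨h, h1, h2⟩
    exact ⟨h, by rw [h1, smul_comm], h2⟩)
  one_smul q := by
    induction q using Quotient.inductionOn with | _ a
    exact congrArg (Quotient.mk _) (Prod.ext (one_smul K a.1) rfl)
  mul_smul k l q := by
    induction q using Quotient.inductionOn with | _ a
    exact congrArg (Quotient.mk _) (Prod.ext (mul_smul k l a.1) rfl)

instance compRight (X : Biset p K H) (Y : Biset p H G) :
    MulAction Gᵐᵒᵖ (Quotient (compSetoid X Y)) where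
  smul g := Quotient.map (fun a => (a.1, g • a.2)) (by
    rintro a b ⟨h, h1, h2⟩
    exact ⟨h, h1, by rw [h2, ← smul_comm h g b.2]⟩)
  one_smul q := by
    induction q using Quotient.inductionOn with | _ a
    exact congrArg (Quotient.mk _) (Prod.ext rfl (one_smul Gᵐᵒᵖ a.2))
  mul_smul k l q := by
    induction q using Quotient.inductionOn with | _ a
    exact congrArg (Quotient.mk _) (Prod.ext rfl (mul_smul k l a.2))

theorem coprime_of_forall_pow {A : Type*} [Group A] {p n : ℕ} (hn : n.Coprime p)
    (S : Subgroup A) [Finite S] (h : ∀ a ∈ S, a ^ n = 1) : IsPPrimeGroup p S := by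
  refine Nat.coprime_of_dvd fun q hq hS hp => ?_
  have := Fact.mk hq
  obtain ⟨a, ha⟩ := exists_prime_orderOf_dvd_card' q hS
  have h1 : a ^ n = 1 := Subtype.ext (by simpa using h a a.2)
  have h2 : q ∣ n := ha ▸ orderOf_dvd_of_pow_eq_one h1
  exact hq.one_lt.ne' (Nat.eq_one_of_dvd_coprimes hn h2 hp)

theorem pow_smul_of_smul_eq {A B X : Type*} [Group A] [Group B] [MulAction A X] [MulAction B X]
    [SMulCommClass A B X] {a : A} {b : B} {x : X} (h : a • x = b • x) (n : ℕ) :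
    a ^ n • x = b ^ n • x := by
  induction n with
  | zero => simp
  | succ n ih => rw [pow_succ, mul_smul, h, smul_comm, ih, ← mul_smul, ← pow_succ']

theorem pow_card_stabilizer {A Y : Type*} [Group A] [MulAction A Y] (y : Y) (h : A)
    (hy : h • y = y) : h ^ Nat.card (MulAction.stabilizer A y) = 1 := by
  have := pow_card_eq_one' (x := (⟨h, hy⟩ : MulAction.stabilizer A y))
  simpa using congrArg Subtype.val this

/-- The composition `X ×_H Y` of a `(K, H)`-biset and an `(H, G)`-biset. -/
def Biset.comp [Finite K] [Finite G] (X : Biset p K H) (Y : Biset p H G) : Biset p K G where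
  carrier := Quotient (compSetoid X Y)
  comm := ⟨fun k g q => by
    induction q using Quotient.inductionOn with | _ a
    rfl⟩
  left_stabilizer q := by
    induction q using Quotient.inductionOn with | _ a
    obtain ⟨x, y⟩ := a
    refine coprime_of_forall_pow
      (Nat.Coprime.mul_left (Y.left_stabilizer y) (X.left_stabilizer x)) _ fun k hk => ?_
    obtain ⟨h, h1, h2⟩ := Quotient.exact (MulAction.mem_stabilizer_iff.mp hk)
    replace h1 : x = op h • k • x := h1
    replace h2 : y = h • y := h2
    have hn := pow_card_stabilizer y h h2.symm
    have hx : k • x = (op h)⁻¹ • x := by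
      rw [eq_inv_smul_iff]; exact h1.symm
    have hx' := pow_smul_of_smul_eq hx (Nat.card (MulAction.stabilizer H y))
    rw [inv_pow, ← op_pow, hn, op_one, inv_one, one_smul] at hx'
    rw [pow_mul]
    exact pow_card_stabilizer x _ hx'
  right_stabilizer q := by
    induction q using Quotient.inductionOn with | _ a
    obtain ⟨x, y⟩ := a
    have : Finite Gᵐᵒᵖ := Finite.of_equiv G opEquiv
    refine coprime_of_forall_pow
      (Nat.Coprime.mul_left (X.right_stabilizer x) (Y.right_stabilizer y)) _ fun g hg => ?_
    obtain ⟨h, h1, h2⟩ := Quotient.exact (MulAction.mem_stabilizer_iff.mp hg)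
    replace h1 : x = op h • x := h1
    replace h2 : g • y = h • y := h2
    have hn := pow_card_stabilizer x (op h) h1.symm
    have hn' : h ^ Nat.card (MulAction.stabilizer Hᵐᵒᵖ x) = 1 := by
      rw [← op_pow] at hn
      exact op_injective hn
    have : SMulCommClass Gᵐᵒᵖ H Y.carrier := SMulCommClass.symm _ _ _
    have hy' := pow_smul_of_smul_eq h2 (Nat.card (MulAction.stabilizer Hᵐᵒᵖ x))
    rw [hn', one_smul] at hy'
    rw [pow_mul]
    exact pow_card_stabilizer y _ hy'

/-- The identity biset: `G` with left and right multiplication. -/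
def Biset.id (p : ℕ) (G : Type u) [Group G] [Finite G] : Biset p G G where
  carrier := G
  left_stabilizer x := by
    have : MulAction.stabilizer G x = ⊥ := by
      ext a; simp
    rw [this]; simp [IsPPrimeGroup]
  right_stabilizer x := by
    have : MulAction.stabilizer Gᵐᵒᵖ x = ⊥ := by
      ext a; simp
    rw [this]; simp [IsPPrimeGroup]

theorem Biset.comp_congr [Finite K] [Finite G] {X X' : Biset p K H} {Y Y' : Biset p H G}
    (e : BisetIso X X') (f : BisetIso Y Y') : X.comp Y ≈ X'.comp Y' := by
  refine ⟨⟨Quotient.congr (Equiv.prodCongr e.toEquiv f.toEquiv) ?_, ?_, ?_⟩⟩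
  · rintro ⟨x, y⟩ ⟨x', y'⟩
    refine exists_congr fun h => and_congr ?_ ?_
    · exact e.toEquiv.injective.eq_iff.symm.trans (Eq.congr_right (e.map_right (op h) x))
    · exact f.toEquiv.injective.eq_iff.symm.trans (Eq.congr_right (f.map_left h y'))
  · intro k q
    induction q using Quotient.inductionOn with | _ a
    exact congrArg (Quotient.mk _) (Prod.ext (e.map_left k a.1) rfl)
  · intro k q
    induction q using Quotient.inductionOn with | _ a
    exact congrArg (Quotient.mk _) (Prod.ext rfl (f.map_right k a.2))

/-- Composition of isomorphism classes of bisets. -/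
def IsoClass.comp [Finite K] [Finite G] : IsoClass p K H → IsoClass p H G → IsoClass p K G :=
  Quotient.map₂ Biset.comp fun _ _ ⟨e⟩ _ _ ⟨f⟩ => Biset.comp_congr e f

theorem IsoClass.zero_comp [Finite K] [Finite G] (b : IsoClass p H G) :
    IsoClass.comp (0 : IsoClass p K H) b = 0 := by
  induction b using Quotient.inductionOn with | _ Y
  refine Quotient.sound ⟨⟨⟨Quotient.lift (fun a => a.1) fun a => a.1.elim, fun x => x.elim,
    ?_, fun x => x.elim⟩, ?_, ?_⟩⟩
  · intro q
    induction q using Quotient.inductionOn with | _ a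
    exact a.1.elim
  all_goals
    intro k q
    induction q using Quotient.inductionOn with | _ a
    exact a.1.elim

theorem IsoClass.comp_zero [Finite K] [Finite G] (a : IsoClass p K H) :
    IsoClass.comp a (0 : IsoClass p H G) = 0 := by
  induction a using Quotient.inductionOn with | _ Y
  refine Quotient.sound ⟨⟨⟨Quotient.lift (fun a => a.2) fun a => a.2.elim, fun x => x.elim,
    ?_, fun x => x.elim⟩, ?_, ?_⟩⟩
  · intro q
    induction q using Quotient.inductionOn with | _ a
    exact a.2.elim
  all_goals
    intro k q
    induction q using Quotient.inductionOn with | _ a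
    exact a.2.elim

theorem IsoClass.add_comp [Finite K] [Finite G] (a a' : IsoClass p K H) (b : IsoClass p H G) :
    IsoClass.comp (a + a') b = IsoClass.comp a b + IsoClass.comp a' b := by
  induction a using Quotient.inductionOn with | _ X
  induction a' using Quotient.inductionOn with | _ X'
  induction b using Quotient.inductionOn with | _ Y
  refine Quotient.sound ⟨⟨⟨Quotient.lift
      (fun a : (X.carrier ⊕ X'.carrier) × Y.carrier =>
        (Sum.map (fun x => Quotient.mk (compSetoid X Y) (x, a.2))
          (fun x => Quotient.mk (compSetoid X' Y) (x, a.2)) a.1)) ?_,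
    Sum.elim
      (Quotient.map (fun a => (Sum.inl a.1, a.2)) ?_)
      (Quotient.map (fun a => (Sum.inr a.1, a.2)) ?_), ?_, ?_⟩, ?_, ?_⟩⟩
  · rintro ⟨x | x, y⟩ ⟨x' | x', y'⟩ ⟨h, h1, h2⟩
    · exact congrArg Sum.inl (Quotient.sound ⟨h, Sum.inl_injective h1, h2⟩)
    · exact absurd h1 (by rintro ⟨⟩)
    · exact absurd h1 (by rintro ⟨⟩)
    · exact congrArg Sum.inr (Quotient.sound ⟨h, Sum.inr_injective h1, h2⟩)
  · rintro a b ⟨h, h1, h2⟩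
    exact ⟨h, congrArg Sum.inl h1, h2⟩
  · rintro a b ⟨h, h1, h2⟩
    exact ⟨h, congrArg Sum.inr h1, h2⟩
  · intro q
    induction q using Quotient.inductionOn with | _ a
    obtain ⟨x | x, y⟩ := a <;> rfl
  · rintro (q | q) <;> induction q using Quotient.inductionOn with | _ a <;> rfl
  all_goals
    intro k q
    induction q using Quotient.inductionOn with | _ a
    obtain ⟨x | x, y⟩ := a <;> rfl

theorem IsoClass.comp_add [Finite K] [Finite G] (a : IsoClass p K H) (b b' : IsoClass p H G) :
    IsoClass.comp a (b + b') = IsoClass.comp a b + IsoClass.comp a b' := by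
  induction a using Quotient.inductionOn with | _ X
  induction b using Quotient.inductionOn with | _ Y
  induction b' using Quotient.inductionOn with | _ Y'
  refine Quotient.sound ⟨⟨⟨Quotient.lift
      (fun a : X.carrier × (Y.carrier ⊕ Y'.carrier) =>
        (Sum.map (fun y => Quotient.mk (compSetoid X Y) (a.1, y))
          (fun y => Quotient.mk (compSetoid X Y') (a.1, y)) a.2)) ?_,
    Sum.elim
      (Quotient.map (fun a => (a.1, Sum.inl a.2)) ?_)
      (Quotient.map (fun a => (a.1, Sum.inr a.2)) ?_), ?_, ?_⟩, ?_, ?_⟩⟩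
  · rintro ⟨x, y | y⟩ ⟨x', y' | y'⟩ ⟨h, h1, h2⟩
    · exact congrArg Sum.inl (Quotient.sound ⟨h, h1, Sum.inl_injective h2⟩)
    · exact absurd h2 (by rintro ⟨⟩)
    · exact absurd h2 (by rintro ⟨⟩)
    · exact congrArg Sum.inr (Quotient.sound ⟨h, h1, Sum.inr_injective h2⟩)
  · rintro a b ⟨h, h1, h2⟩
    exact ⟨h, h1, congrArg Sum.inl h2⟩
  · rintro a b ⟨h, h1, h2⟩
    exact ⟨h, h1, congrArg Sum.inr h2⟩
  · intro q
    induction q using Quotient.inductionOn with | _ a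
    obtain ⟨x, y | y⟩ := a <;> rfl
  · rintro (q | q) <;> induction q using Quotient.inductionOn with | _ a <;> rfl
  all_goals
    intro k q
    induction q using Quotient.inductionOn with | _ a
    obtain ⟨x, y | y⟩ := a <;> rfl

theorem IsoClass.comp_assoc [Finite K] [Finite H] [Finite G] [Finite F] (a : IsoClass p K H)
    (b : IsoClass p H G) (c : IsoClass p G F) :
    IsoClass.comp (IsoClass.comp a b) c = IsoClass.comp a (IsoClass.comp b c) := by
  induction a using Quotient.inductionOn with | _ X
  induction b using Quotient.inductionOn with | _ Y
  induction c using Quotient.inductionOn with | _ Z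
  refine Quotient.sound ⟨⟨⟨Quotient.lift
      (fun a : Quotient (compSetoid X Y) × Z.carrier =>
        Quotient.lift (fun t : X.carrier × Y.carrier =>
          Quotient.mk (compSetoid X (Y.comp Z)) (t.1, Quotient.mk (compSetoid Y Z) (t.2, a.2)))
          ?_ a.1) ?_,
    Quotient.lift
      (fun a : X.carrier × Quotient (compSetoid Y Z) =>
        Quotient.lift (fun t : Y.carrier × Z.carrier =>
          Quotient.mk (compSetoid (X.comp Y) Z) (Quotient.mk (compSetoid X Y) (a.1, t.1), t.2))
          ?_ a.2) ?_, ?_, ?_⟩, ?_, ?_⟩⟩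
  · rintro ⟨x, y⟩ ⟨x', y'⟩ ⟨h, h1, h2⟩
    exact Quotient.sound ⟨h, h1, congrArg (fun t => Quotient.mk (compSetoid Y Z) (t, a.2)) h2⟩
  · rintro ⟨q, z⟩ ⟨q', z'⟩ ⟨g, h1, h2⟩
    induction q using Quotient.inductionOn with | _ t
    replace h1 : q' = Quotient.mk (compSetoid X Y) (t.1, op g • t.2) := h1
    subst h1
    exact congrArg (fun s => Quotient.mk (compSetoid X (Y.comp Z)) (t.1, s))
      (Quotient.sound ⟨g, rfl, h2⟩)
  · rintro ⟨y, z⟩ ⟨y', z'⟩ ⟨g, h1, h2⟩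
    exact Quotient.sound ⟨g, congrArg (fun t => Quotient.mk (compSetoid X Y) (a.1, t)) h1, h2⟩
  · rintro ⟨x, q⟩ ⟨x', q'⟩ ⟨h, h1, h2⟩
    induction q' using Quotient.inductionOn with | _ t
    replace h2 : q = Quotient.mk (compSetoid Y Z) (h • t.1, t.2) := h2
    subst h2
    exact congrArg (fun s => Quotient.mk (compSetoid (X.comp Y) Z) (s, t.2))
      (Quotient.sound ⟨h, h1, rfl⟩)
  · rintro ⟨q, z⟩
    induction q using Quotient.inductionOn with | _ t
    rfl
  · rintro ⟨x, q⟩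
    induction q using Quotient.inductionOn with | _ t
    rfl
  all_goals
    rintro k ⟨q, z⟩
    induction q using Quotient.inductionOn with | _ t
    rfl

theorem IsoClass.id_comp [Finite H] [Finite G] (a : IsoClass p H G) :
    IsoClass.comp (Quotient.mk _ (Biset.id p H)) a = a := by
  induction a using Quotient.inductionOn with | _ X
  refine Quotient.sound ⟨⟨⟨Quotient.lift (fun a : H × X.carrier => a.1 • a.2) ?_,
    fun x => Quotient.mk (compSetoid (Biset.id p H) X) ((1 : H), x), ?_, ?_⟩, ?_, ?_⟩⟩
  · rintro ⟨(x : H), y⟩ ⟨(x' : H), y'⟩ ⟨h, h1, h2⟩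
    replace h1 : x' = x * h := h1
    replace h2 : y = h • y' := h2
    change x • y = x' • y'
    rw [h1, h2, mul_smul]
  · rintro ⟨(h : H), x⟩
    exact Quotient.sound ⟨h, (one_mul h).symm, rfl⟩
  · intro x
    exact one_smul H x
  · rintro k ⟨(h : H), x⟩
    exact mul_smul k h x
  · rintro k ⟨(h : H), x⟩
    exact smul_comm h k x

theorem IsoClass.comp_id [Finite H] [Finite G] (a : IsoClass p H G) :
    IsoClass.comp a (Quotient.mk _ (Biset.id p G)) = a := by
  induction a using Quotient.inductionOn with | _ X
  refine Quotient.sound ⟨⟨⟨Quotient.lift (fun a : X.carrier × G => op a.2 • a.1) ?_,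
    fun x => Quotient.mk (compSetoid X (Biset.id p G)) (x, (1 : G)), ?_, ?_⟩, ?_, ?_⟩⟩
  · rintro ⟨x, (y : G)⟩ ⟨x', (y' : G)⟩ ⟨h, h1, h2⟩
    replace h1 : x' = op h • x := h1
    replace h2 : y = h * y' := h2
    change op y • x = op y' • x'
    rw [h1, h2, op_mul, mul_smul]
  · rintro ⟨x, (g : G)⟩
    exact Quotient.sound
      ⟨g⁻¹, (inv_smul_smul (op g) x).symm, (inv_mul_cancel g).symm⟩
  · intro x
    exact one_smul Gᵐᵒᵖ x
  · rintro k ⟨x, (g : G)⟩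
    exact (smul_comm k (op g) x).symm
  · rintro k ⟨x, (g : G)⟩
    exact mul_smul k (op g) x

/-! ### The groups `B^Δ(H, G)` and the modules `R B^Δ(H, G)` -/

/-- The Grothendieck group of `p`-bifree `(H, G)`-bisets with respect to disjoint unions. -/
abbrev B (p : ℕ) (H G : Type u) [Group H] [Group G] : Type (u + 1) :=
  Algebra.GrothendieckAddGroup (IsoClass p H G)

/-- The scalar extension of `B^Δ(H, G)` to `R`. -/
abbrev RB (p : ℕ) (R : Type v) [CommRing R] (H G : Type u) [Group H] [Group G] :
    Type (max (u + 1) v) :=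
  R ⊗[ℤ] B p H G

/-- The class of a biset in `B^Δ(H, G)`. -/
def Biset.cls (X : Biset p H G) : B p H G :=
  Algebra.GrothendieckAddGroup.of (Quotient.mk _ X : IsoClass p H G)

/-- Two additive maps on `B^Δ(H, G)` agree if they agree on classes of bisets. -/
theorem B.hom_ext {A : Type*} [AddCommGroup A] {f g : B p H G →ₗ[ℤ] A}
    (h : ∀ X : Biset p H G, f X.cls = g X.cls) : f = g := by
  have : f.toAddMonoidHom = g.toAddMonoidHom := by
    apply Algebra.GrothendieckAddGroup.lift.symm.injective
    ext a
    induction a using Quotient.inductionOn with | _ X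
    exact h X
  ext x
  exact DFunLike.congr_fun this x

/-- The extension of an additive function on isomorphism classes of bisets to `B^Δ(H, G)`. -/
def B.lift {A : Type*} [AddCommGroup A] (f : IsoClass p H G →+ A) : B p H G →ₗ[ℤ] A :=
  (Algebra.GrothendieckAddGroup.lift f).toIntLinearMap

theorem B.lift_cls {A : Type*} [AddCommGroup A] (f : IsoClass p H G →+ A) (X : Biset p H G) :
    B.lift f X.cls = f (Quotient.mk _ X) :=
  DFunLike.congr_fun (Algebra.GrothendieckAddGroup.lift.symm_apply_apply f) (Quotient.mk _ X)

/-- The biadditive map `B^Δ(K, H) × B^Δ(H, G) → B^Δ(K, G)` induced by composition of bisets. -/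
def B.comp (p : ℕ) (K H G : Type u) [Group K] [Group H] [Group G] [Finite K] [Finite G] :
    B p K H →ₗ[ℤ] B p H G →ₗ[ℤ] B p K G :=
  B.lift
    { toFun := fun a => B.lift
        (Algebra.GrothendieckAddGroup.of.comp
          { toFun := fun b => IsoClass.comp a b
            map_zero' := IsoClass.comp_zero a
            map_add' := IsoClass.comp_add a })
      map_zero' := B.hom_ext fun X => by
        rw [B.lift_cls]
        exact (congrArg Algebra.GrothendieckAddGroup.of (IsoClass.zero_comp (K := K) (Quotient.mk _ X))).trans
          (map_zero Algebra.GrothendieckAddGroup.of)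
      map_add' := fun a a' => B.hom_ext fun X => by
        rw [LinearMap.add_apply, B.lift_cls, B.lift_cls, B.lift_cls]
        exact (congrArg Algebra.GrothendieckAddGroup.of (IsoClass.add_comp _ _ _)).trans
          (map_add Algebra.GrothendieckAddGroup.of _ _) }

theorem B.comp_cls [Finite K] [Finite G] (X : Biset p K H) (Y : Biset p H G) :
    B.comp p K H G X.cls Y.cls = (X.comp Y).cls := by
  simp only [B.comp, B.lift_cls]
  erw [B.lift_cls]
  rfl

/-- The `R`-bilinear extension of the composition of bisets. -/
def RB.comp (p : ℕ) (R : Type v) [CommRing R] (K H G : Type u) [Group K] [Group H] [Group G]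
    [Finite K] [Finite G] : RB p R K H →ₗ[R] RB p R H G →ₗ[R] RB p R K G :=
  LinearMap.liftBaseChange R (LinearMap.baseChangeHom ℤ R _ _ ∘ₗ B.comp p K H G)

theorem RB.comp_tmul {R : Type v} [CommRing R] [Finite K] [Finite G] (r s : R)
    (a : B p K H) (b : B p H G) :
    RB.comp p R K H G (r ⊗ₜ a) (s ⊗ₜ b) = (r * s) ⊗ₜ B.comp p K H G a b := by
  simp [RB.comp, TensorProduct.smul_tmul']

theorem B.induction {P : B p H G → Prop} (cls : ∀ X : Biset p H G, P X.cls) (zero : P 0)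
    (add : ∀ a b, P a → P b → P (a + b)) (smul : ∀ (n : ℤ) a, P a → P (n • a)) (a : B p H G) :
    P a := by
  have h : Submodule.span ℤ (Set.range (Biset.cls (p := p) (H := H) (G := G))) = ⊤ := by
    rw [← Submodule.ker_mkQ (Submodule.span ℤ _), LinearMap.ker_eq_top]
    refine B.hom_ext fun X => ?_
    simpa using Submodule.subset_span (Set.mem_range_self X)
  have ha : a ∈ Submodule.span ℤ (Set.range (Biset.cls (p := p) (H := H) (G := G))) := by simp [h]
  induction ha using Submodule.span_induction with
  | mem x hx => obtain ⟨X, rfl⟩ := hx; exact cls X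
  | zero => exact zero
  | add x y _ _ hx hy => exact add x y hx hy
  | smul n x _ hx => exact smul n x hx

theorem RB.induction {R : Type v} [CommRing R] {P : RB p R H G → Prop}
    (cls : ∀ X : Biset p H G, P (1 ⊗ₜ X.cls)) (zero : P 0)
    (add : ∀ a b, P a → P b → P (a + b)) (smul : ∀ (r : R) a, P a → P (r • a)) (a : RB p R H G) :
    P a := by
  induction a using TensorProduct.induction_on with
  | zero => exact zero
  | add x y hx hy => exact add x y hx hy
  | tmul r b =>
    suffices h : P (1 ⊗ₜ b) by
      simpa [TensorProduct.smul_tmul'] using smul r _ h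
    induction b using B.induction with
    | cls X => exact cls X
    | zero => simpa using zero
    | add a b ha hb => rw [TensorProduct.tmul_add]; exact add _ _ ha hb
    | smul n a ha =>
      have := smul (n : R) _ ha
      rwa [Int.cast_smul_eq_zsmul, ← TensorProduct.tmul_smul] at this

theorem RB.comp_cls {R : Type v} [CommRing R] [Finite K] [Finite G] (X : Biset p K H)
    (Y : Biset p H G) :
    RB.comp p R K H G (1 ⊗ₜ X.cls) (1 ⊗ₜ Y.cls) = 1 ⊗ₜ (X.comp Y).cls := by
  rw [RB.comp_tmul, B.comp_cls, one_mul]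

theorem RB.comp_assoc {R : Type v} [CommRing R] [Finite K] [Finite H] [Finite G] [Finite F]
    (a : RB p R K H) (b : RB p R H G) (c : RB p R G F) :
    RB.comp p R K G F (RB.comp p R K H G a b) c =
      RB.comp p R K H F a (RB.comp p R H G F b c) := by
  induction a using RB.induction with
  | zero => simp
  | add a a' h h' => simp [h, h']
  | smul r a h => simp [h]
  | cls X =>
    induction b using RB.induction with
    | zero => simp
    | add a a' h h' => simp [h, h']
    | smul r a h => simp [h]
    | cls Y =>
      induction c using RB.induction with
      | zero => simp
      | add a a' h h' => simp [h, h']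
      | smul r a h => simp [h]
      | cls Z =>
        simp only [RB.comp_cls]
        exact congrArg (fun t => (1 : R) ⊗ₜ[ℤ] Algebra.GrothendieckAddGroup.of t)
          (IsoClass.comp_assoc (Quotient.mk _ X) (Quotient.mk _ Y) (Quotient.mk _ Z))

theorem RB.id_comp {R : Type v} [CommRing R] [Finite H] [Finite G] (a : RB p R H G) :
    RB.comp p R H H G (1 ⊗ₜ (Biset.id p H).cls) a = a := by
  induction a using RB.induction with
  | zero => simp
  | add a a' h h' => simp [h, h']
  | smul r a h => simp [h]
  | cls X =>
    rw [RB.comp_cls]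
    exact congrArg (fun t => (1 : R) ⊗ₜ[ℤ] Algebra.GrothendieckAddGroup.of t)
      (IsoClass.id_comp (Quotient.mk _ X))

theorem RB.comp_id {R : Type v} [CommRing R] [Finite H] [Finite G] (a : RB p R H G) :
    RB.comp p R H G G a (1 ⊗ₜ (Biset.id p G).cls) = a := by
  induction a using RB.induction with
  | zero => simp
  | add a a' h h' => simp [h, h']
  | smul r a h => simp [h]
  | cls X =>
    rw [RB.comp_cls]
    exact congrArg (fun t => (1 : R) ⊗ₜ[ℤ] Algebra.GrothendieckAddGroup.of t)
      (IsoClass.comp_id (Quotient.mk _ X))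

end Bisets

/-! ### The `p`-bifree biset category -/

/-- The category `R C^Δ`: the objects are the finite groups. -/
structure Cat (p : ℕ) (R : Type v) [CommRing R] where
  carrier : Type u
  [group : Group carrier]
  [finite : Finite carrier]

attribute [instance] Cat.group Cat.finite

section Category

variable {p : ℕ} {R : Type v} [CommRing R]

/-- The morphisms `G ⟶ H` are the elements of `R B^Δ(H, G)`; composition is the bilinear extension
of the composition of bisets. -/
instance : Category.{max (u + 1) v} (Cat.{u, v} p R) where
  Hom G H := RB p R H.carrier G.carrier
  id G := 1 ⊗ₜ (Biset.id p G.carrier).cls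
  comp {_ _ _} f g := RB.comp p R _ _ _ g f
  id_comp f := RB.comp_id f
  comp_id f := RB.id_comp f
  assoc f g h := (RB.comp_assoc h g f).symm

instance : Preadditive (Cat.{u, v} p R) where
  homGroup G H := inferInstanceAs (AddCommGroup (RB p R H.carrier G.carrier))
  add_comp _ _ _ f f' g := LinearMap.map_add (RB.comp p R _ _ _ g) f f'
  comp_add _ _ _ f g g' := LinearMap.map_add₂ (RB.comp p R _ _ _) g g' f

instance : Linear R (Cat.{u, v} p R) where
  homModule G H := inferInstanceAs (Module R (RB p R H.carrier G.carrier))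
  smul_comp _ _ _ r f g := LinearMap.map_smul (RB.comp p R _ _ _ g) r f
  comp_smul _ _ _ f r g := LinearMap.map_smul₂ (RB.comp p R _ _ _) r g f

end Category

/-! ### The functors `L_{G,V}`, `J_{G,V}` and `S_{G,V}` -/

section Simple

variable {p : ℕ} {R : Type v} [CommRing R] {G : Cat.{u, v} p R} {V : Type w} [AddCommGroup V]
  [Module R V] (ρ : End G →ₐ[R] Module.End R V)

/-- The relations `(x · e) ⊗ v = x ⊗ (e · v)`, for `e` in the endomorphism algebra of `G`,
that cut out the tensor product over this algebra from the tensor product over `R`. -/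
def balanced (H : Cat.{u, v} p R) : Submodule R ((G ⟶ H) ⊗[R] V) :=
  Submodule.span R
    {t | ∃ (x : G ⟶ H) (e : End G) (v : V), t = (e.asHom ≫ x) ⊗ₜ[R] v - x ⊗ₜ[R] ρ e v}

/-- `L_{G,V}(H) = R B^Δ(H, G) ⊗_{E_G} V`, where `E_G = R B^Δ(G, G)` and `V` is the `E_G`-module
given by `ρ`. -/
abbrev L (H : Cat.{u, v} p R) : Type (max (u + 1) v w) :=
  ((G ⟶ H) ⊗[R] V) ⧸ balanced ρ H

/-- The action of a morphism on `L_{G,V}`, `x ⊗ v ↦ (α · x) ⊗ v`. -/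
def L.map {H H' : Cat.{u, v} p R} (α : H ⟶ H') : L ρ H →ₗ[R] L ρ H' :=
  Submodule.mapQ _ _ ((Linear.rightComp R G α).rTensor V) (by
    rw [balanced, Submodule.span_le]
    rintro _ ⟨x, e, v, rfl⟩
    refine Submodule.subset_span ⟨x ≫ α, e, v, ?_⟩
    simp)

/-- The map `L_{G,V}(H) → V`, `x ⊗ v ↦ (y · x) v` for `y ∈ R B^Δ(G, H)`. -/
def L.eval {H : Cat.{u, v} p R} (y : H ⟶ G) : L ρ H →ₗ[R] V :=
  Submodule.liftQ _
    (TensorProduct.lift (ρ.toLinearMap ∘ₗ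
      (show (G ⟶ H) →ₗ[R] End G from Linear.rightComp R G y))) (by
    rw [balanced, Submodule.span_le]
    rintro _ ⟨x, e, v, rfl⟩
    have : ρ (End.of ((e.asHom ≫ x) ≫ y)) v = ρ (End.of (x ≫ y)) (ρ e v) := by
      rw [Category.assoc, ← Module.End.mul_apply, ← map_mul]
      rfl
    rw [SetLike.mem_coe, LinearMap.mem_ker, map_sub, sub_eq_zero]
    exact this)

/-- `J_{G,V}(H)`: the elements `∑ xᵢ ⊗ vᵢ` with `∑ (y · xᵢ) vᵢ = 0` for all `y ∈ R B^Δ(G, H)`. -/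
def J (H : Cat.{u, v} p R) : Submodule R (L ρ H) :=
  ⨅ y : H ⟶ G, LinearMap.ker (L.eval ρ y)

theorem L.eval_map {H H' : Cat.{u, v} p R} (α : H ⟶ H') (y : H' ⟶ G) (t : L ρ H) :
    L.eval ρ y (L.map ρ α t) = L.eval ρ (α ≫ y) t := by
  obtain ⟨t, rfl⟩ := Submodule.mkQ_surjective _ t
  induction t using TensorProduct.induction_on with
  | zero => simp
  | add a b ha hb => simp only [map_add, ha, hb]
  | tmul x v => exact congrArg (fun t => ρ (End.of t) v) (Category.assoc x α y)

/-- The action of a morphism on `L_{G,V} / J_{G,V}`. -/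
def S.mapHom {H H' : Cat.{u, v} p R} (α : H ⟶ H') : (L ρ H ⧸ J ρ H) →ₗ[R] (L ρ H' ⧸ J ρ H') :=
  Submodule.mapQ _ _ (L.map ρ α) (by
    intro t ht
    simp only [J, Submodule.mem_comap, Submodule.mem_iInf, LinearMap.mem_ker] at ht ⊢
    intro y
    rw [L.eval_map, ht])

/-- The class of `x ⊗ v` in `L_{G,V}(H) / J_{G,V}(H)`. -/
def S.mk {H : Cat.{u, v} p R} (x : G ⟶ H) (v : V) : L ρ H ⧸ J ρ H :=
  Submodule.Quotient.mk (Submodule.Quotient.mk (x ⊗ₜ[R] v))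

theorem S.mapHom_mk {H H' : Cat.{u, v} p R} (α : H ⟶ H') (x : G ⟶ H) (v : V) :
    S.mapHom ρ α (S.mk ρ x v) = S.mk ρ (x ≫ α) v := rfl

theorem S.hom_ext {H : Cat.{u, v} p R} {M : Type*} [AddCommGroup M] [Module R M]
    {f g : (L ρ H ⧸ J ρ H) →ₗ[R] M} (h : ∀ x v, f (S.mk ρ x v) = g (S.mk ρ x v)) : f = g := by
  refine Submodule.linearMap_qext _ (Submodule.linearMap_qext _ (TensorProduct.ext' h))

/-- The `p`-bifree biset functor `S_{G,V} = L_{G,V} / J_{G,V}`. -/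
def S : Cat.{u, v} p R ⥤ ModuleCat.{max (u + 1) v w} R where
  obj H := ModuleCat.of R (L ρ H ⧸ J ρ H)
  map α := ModuleCat.ofHom (S.mapHom ρ α)
  map_id H := ModuleCat.hom_ext (S.hom_ext ρ fun x v => by
    simp [S.mapHom_mk])
  map_comp α β := ModuleCat.hom_ext (S.hom_ext ρ fun x v => by
    simp [S.mapHom_mk])

instance : (S ρ).Additive where
  map_add {H H' α β} := ModuleCat.hom_ext (S.hom_ext ρ fun x v => by
    change S.mapHom ρ (α + β) _ = S.mapHom ρ α _ + S.mapHom ρ β _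
    simp only [S.mapHom_mk, Preadditive.comp_add]
    simp [S.mk, TensorProduct.add_tmul])

instance : (S ρ).Linear R where
  map_smul {H H'} α r := ModuleCat.hom_ext (S.hom_ext ρ fun x v => by
    change S.mapHom ρ (r • α) _ = r • S.mapHom ρ α _
    simp only [S.mapHom_mk, Linear.comp_smul]
    simp [S.mk, ← TensorProduct.smul_tmul'])

end Simple

/-! ### The simple functor attached to the trivial group and the trivial module -/

section Trivial

/-- The trivial group. -/
def Triv : Type u := PUnit

instance : Group Triv.{u} := inferInstanceAs (Group PUnit)

instance : Unique Triv.{u} := inferInstanceAs (Unique PUnit)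

variable (p : ℕ) (R : Type v) [CommRing R]

/-- The trivial group as an object of the `p`-bifree biset category. -/
abbrev one : Cat.{u, v} p R where
  carrier := Triv.{u}

/-- The number of elements of a `(1, 1)`-biset, as an additive function on isomorphism classes. -/
def cardHom : IsoClass p Triv.{u} Triv.{u} →+ R where
  toFun := Quotient.lift (fun X => (Nat.card X.carrier : R)) fun _ _ ⟨e⟩ => by
    rw [Nat.card_congr e.toEquiv]
  map_zero' := by
    change ((Nat.card PEmpty : ℕ) : R) = 0
    simp
  map_add' a b := by
    induction a using Quotient.inductionOn with | _ X
    induction b using Quotient.inductionOn with | _ Y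
    change ((Nat.card (X.carrier ⊕ Y.carrier) : ℕ) : R) = Nat.card X.carrier + Nat.card Y.carrier
    rw [Nat.card_sum, Nat.cast_add]

/-- The linear extension of `[X] ↦ |X|` to `R B^Δ(1, 1)`. -/
def augLinear : RB p R Triv.{u} Triv.{u} →ₗ[R] R :=
  LinearMap.liftBaseChange R (B.lift (cardHom p R))

theorem augLinear_cls (X : Biset p Triv.{u} Triv.{u}) :
    augLinear p R (1 ⊗ₜ X.cls) = Nat.card X.carrier := by
  rw [augLinear, LinearMap.liftBaseChange_tmul, one_smul, B.lift_cls]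
  rfl

theorem card_comp_triv (X Y : Biset p Triv.{u} Triv.{u}) :
    Nat.card (X.comp Y).carrier = Nat.card X.carrier * Nat.card Y.carrier := by
  rw [← Nat.card_prod]
  refine (Nat.card_congr (Equiv.ofBijective (Quotient.mk (compSetoid X Y)) ⟨?_, ?_⟩)).symm
  · rintro ⟨x, y⟩ ⟨x', y'⟩ h
    obtain ⟨h, h1, h2⟩ := Quotient.exact h
    replace h1 : x' = op h • x := h1
    replace h2 : y = h • y' := h2
    rw [Subsingleton.elim h 1] at h1 h2
    rw [op_one, one_smul] at h1
    rw [one_smul] at h2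
    rw [h1, h2]
  · exact Quotient.mk_surjective

theorem augLinear_comp (a b : RB p R Triv.{u} Triv.{u}) :
    augLinear p R (RB.comp p R _ _ _ a b) = augLinear p R a * augLinear p R b := by
  induction a using RB.induction with
  | zero => simp
  | add a a' h h' => simp [h, h', add_mul]
  | smul r a h => simp [h, mul_assoc]
  | cls X =>
    induction b using RB.induction with
    | zero => simp
    | add a a' h h' => simp [h, h', mul_add]
    | smul r a h => simp [h, mul_left_comm]
    | cls Y => rw [RB.comp_cls, augLinear_cls, augLinear_cls, augLinear_cls, card_comp_triv,
        Nat.cast_mul]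

/-- The canonical algebra homomorphism `E_1 = R B^Δ(1, 1) → R`. A `(1, 1)`-biset `X` is a disjoint
union of `|X|` copies of the identity biset, so `[X] = |X| · id` is sent to `|X|`. -/
def aug : End (one.{u, v} p R) →ₐ[R] R :=
  AlgHom.ofLinearMap (augLinear p R)
    ((augLinear_cls p R (Biset.id p Triv.{u})).trans (by simp [Biset.id]))
    (augLinear_comp p R)

/-- The trivial module `R` of `R Out(1) = R`, as a module for `E_1 = R B^Δ(1, 1)`. There are no
groups of order less than `1`, so the essential algebra of the trivial group is `E_1` itself, and
the only `R`-linear unital action of `E_1 = R · id` on `R` is the one by scalars. -/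
def trivialModule : End (one.{u, v} p R) →ₐ[R] Module.End R R :=
  (Algebra.lmul R R).comp (aug p R)

/-- The functor `S_{1,R}`. -/
abbrev STrivial : Cat.{u, v} p R ⥤ ModuleCat.{max (u + 1) v} R :=
  S (trivialModule.{u, v} p R)

end Trivial

/-! ### Conjugacy classes of cyclic `p'`-subgroups -/

/-- The cyclic `p'`-subgroups of a group. -/
abbrev CyclicPPrimeSubgroup (p : ℕ) (G : Type u) [Group G] : Type u :=
  {C : Subgroup G // IsCyclic C ∧ IsPPrimeGroup p C}

/-- Conjugacy of cyclic `p'`-subgroups. -/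
def conjSetoid (p : ℕ) (G : Type u) [Group G] : Setoid (CyclicPPrimeSubgroup p G) where
  r C D := ∃ g : G, D.1 = C.1.map (MulAut.conj g).toMonoidHom
  iseqv :=
    { refl := fun C => ⟨1, by ext; simp⟩
      symm := by
        rintro C D ⟨g, h⟩
        refine ⟨g⁻¹, ?_⟩
        rw [h, Subgroup.map_map]
        ext; simp [MulAut.conj, mul_assoc]
      trans := by
        rintro C D E ⟨g, h⟩ ⟨k, h'⟩
        refine ⟨k * g, ?_⟩
        rw [h', h, Subgroup.map_map]
        ext; simp [mul_assoc] }

end PBifree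
end

/-! `J` is by definition the common kernel of the functionals `L.eval y`, and for the trivial module
these send `x ⊗ v` to `v` times the linear extension of `|Y ×_G X|`. So the evaluation at `G` is the
quotient of `𝕂B^Δ(G, 1)` by the radical of the pairing `(Y, X) ↦ |Y ×_G X|`, and its dimension is
the rank of this pairing.

The set `Y ×_G X` is the set of `G`-orbits on `Y × X`, so the Cauchy-Frobenius formula gives `|G| ·
|Y ×_G X| = ∑_g |Y^g| |X^g|` (`card_comp_mul_card`). Since point stabilizers are `p'`-groups, only
the `g` that generate a `p'`-subgroup contribute, and the fixed point numbers depend only on the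
conjugacy class of `⟨g⟩`. Grouping the sum by classes (`card_comp_mul_card_eq_sum_classes`) makes
the pairing diagonal in the coordinates given by marks at the classes of cyclic `p'`-subgroups. Its
weights, the number of generators divided by `|G|`, are nonzero in characteristic zero.

The marks are surjective on both sides because the table of marks of the transitive sets `G / D` is
triangular with nonzero diagonal (`eq_top_of_forall_leftMark_mem`). Hence the radical is exactly the
kernel of the marks, and the quotient is the space of functions on the classes
(`nonempty_quotient_equiv_of_diagonal`). -/

noncomputable section

namespace PBifree

/-! ### Quotients by the radical of a diagonal pairing -/

section LinearAlgebra

/-- If the functionals `e y` are given by a diagonal form with nonzero weights in coordinates `m`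
and `n`, both surjective, then the quotient by their common kernel is the coordinate space. -/
theorem nonempty_quotient_equiv_of_diagonal {𝕂 M L N Q : Type*} [Field 𝕂] [AddCommGroup M]
    [Module 𝕂 M] [AddCommGroup L] [Module 𝕂 L] [Fintype Q] (π : M →ₗ[𝕂] L)
    (hπ : Function.Surjective π) (m : M →ₗ[𝕂] Q → 𝕂) (hm : Function.Surjective m)
    (n : N → Q → 𝕂) (hn : Function.Surjective n) (w : Q → 𝕂) (hw : ∀ q, w q ≠ 0)
    (e : N → L →ₗ[𝕂] 𝕂) (he : ∀ y x, e y (π x) = ∑ q, w q * (n y q * m x q)) :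
    Nonempty ((L ⧸ ⨅ y, LinearMap.ker (e y)) ≃ₗ[𝕂] (Q → 𝕂)) := by
  classical
  let φ := (⨅ y, LinearMap.ker (e y)).mkQ ∘ₗ π
  have hφ : Function.Surjective φ := (Submodule.mkQ_surjective _).comp hπ
  have hk : LinearMap.ker φ = LinearMap.ker m := by
    ext x
    have : x ∈ LinearMap.ker φ ↔ ∀ y, e y (π x) = 0 := by
      simp [φ, Submodule.mem_iInf]
    rw [this, LinearMap.mem_ker]
    refine ⟨fun h => ?_, fun h y => by simp [he, h]⟩
    funext q
    -- Pairing with a `y` whose coordinates form a unit vector isolates `w q * m x q`, and `w q` can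
    -- be cancelled.
    obtain ⟨y, hy⟩ := hn (Pi.single q 1)
    have hq := h y
    rw [he, hy, Finset.sum_eq_single q (fun r _ hr => by simp [hr]) (by simp)] at hq
    simpa [hw q] using hq
  exact ⟨(φ.quotKerEquivOfSurjective hφ).symm ≪≫ₗ Submodule.quotEquivOfEq _ _ hk ≪≫ₗ
    m.quotKerEquivOfSurjective hm⟩

end LinearAlgebra

/-! ### Fixed point numbers of subgroups -/

section Marks

variable {p : ℕ} {H G : Type u} [Group H] [Group G] (R : Type v) [CommRing R]

/-- The number of elements satisfying an isomorphism invariant property compatible with disjoint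
unions, as an additive function on isomorphism classes of bisets. -/
def countHom (P : ∀ X : Biset p H G, X.carrier → Prop)
    (iso : ∀ (X Y : Biset p H G) (e : BisetIso X Y) x, P X x ↔ P Y (e.toEquiv x))
    (inl : ∀ (X Y : Biset p H G) x, P (X.sum Y) (Sum.inl x) ↔ P X x)
    (inr : ∀ (X Y : Biset p H G) y, P (X.sum Y) (Sum.inr y) ↔ P Y y) :
    IsoClass p H G →+ R where
  toFun := Quotient.lift (fun X => (Nat.card {x // P X x} : R)) fun X Y ⟨e⟩ => by
    rw [Nat.card_congr (e.toEquiv.subtypeEquiv (iso X Y e))]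
  map_zero' := by
    have : IsEmpty {x : (Biset.empty p H G).carrier // P (Biset.empty p H G) x} :=
      ⟨fun x => PEmpty.elim x.1⟩
    change ((Nat.card {x // P (Biset.empty p H G) x} : ℕ) : R) = 0
    simp
  map_add' a b := by
    induction a using Quotient.inductionOn with | _ X
    induction b using Quotient.inductionOn with | _ Y
    change ((Nat.card {x // P (X.sum Y) x} : ℕ) : R) =
      Nat.card {x // P X x} + Nat.card {x // P Y x}
    rw [← Nat.cast_add, ← Nat.card_sum]
    exact congrArg Nat.cast (Nat.card_congr (Equiv.subtypeSum.trans (Equiv.sumCongr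
      (Equiv.subtypeEquivRight (inl X Y)) (Equiv.subtypeEquivRight (inr X Y)))))

/-- The number of fixed points of a subgroup acting on the left. -/
def leftMark (C : Subgroup H) (X : Biset p H G) : ℕ :=
  Nat.card {x : X.carrier // ∀ c ∈ C, c • x = x}

/-- The number of fixed points of a subgroup acting on the right. -/
def rightMark (C : Subgroup G) (X : Biset p H G) : ℕ :=
  Nat.card {x : X.carrier // ∀ c ∈ C, op c • x = x}

/-- The linear extension of `leftMark`. -/
def leftMarkLinear (C : Subgroup H) : RB p R H G →ₗ[R] R :=
  LinearMap.liftBaseChange R (B.lift (countHom R (fun _ x => ∀ c ∈ C, c • x = x)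
    (fun _ _ e x => forall₂_congr fun c _ =>
      e.toEquiv.injective.eq_iff.symm.trans (Eq.congr_left (e.map_left c x)))
    (fun _ _ _ => forall₂_congr fun _ _ => Sum.inl_injective.eq_iff)
    (fun _ _ _ => forall₂_congr fun _ _ => Sum.inr_injective.eq_iff)))

/-- The linear extension of `rightMark`. -/
def rightMarkLinear (C : Subgroup G) : RB p R H G →ₗ[R] R :=
  LinearMap.liftBaseChange R (B.lift (countHom R (fun _ x => ∀ c ∈ C, op c • x = x)
    (fun _ _ e x => forall₂_congr fun c _ =>
      e.toEquiv.injective.eq_iff.symm.trans (Eq.congr_left (e.map_right (op c) x)))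
    (fun _ _ _ => forall₂_congr fun _ _ => Sum.inl_injective.eq_iff)
    (fun _ _ _ => forall₂_congr fun _ _ => Sum.inr_injective.eq_iff)))

theorem leftMarkLinear_cls (C : Subgroup H) (X : Biset p H G) :
    leftMarkLinear R C (1 ⊗ₜ X.cls) = leftMark C X := by
  rw [leftMarkLinear, LinearMap.liftBaseChange_tmul, one_smul, B.lift_cls]
  rfl

theorem rightMarkLinear_cls (C : Subgroup G) (X : Biset p H G) :
    rightMarkLinear R C (1 ⊗ₜ X.cls) = rightMark C X := by
  rw [rightMarkLinear, LinearMap.liftBaseChange_tmul, one_smul, B.lift_cls]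
  rfl

/-- Translation by `g` maps the fixed points of `C` bijectively onto those of `gCg⁻¹`. -/
theorem leftMark_map_conj (g : H) (C : Subgroup H) (X : Biset p H G) :
    leftMark (C.map (MulAut.conj g).toMonoidHom) X = leftMark C X := by
  refine (Nat.card_congr ((MulAction.toPerm g).subtypeEquiv fun x => ?_)).symm
  simp only [Subgroup.mem_map, forall_exists_index, and_imp, forall_apply_eq_imp_iff₂]
  refine forall₂_congr fun c _ => ?_
  simp [mul_smul]

/-- On the right the bijection is `x ↦ x g⁻¹`, since `(x g⁻¹)(g c g⁻¹) = (x c) g⁻¹`. -/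
theorem rightMark_map_conj (g : G) (C : Subgroup G) (X : Biset p H G) :
    rightMark (C.map (MulAut.conj g).toMonoidHom) X = rightMark C X := by
  refine (Nat.card_congr ((MulAction.toPerm (op g⁻¹)).subtypeEquiv fun x => ?_)).symm
  simp only [Subgroup.mem_map, forall_exists_index, and_imp, forall_apply_eq_imp_iff₂]
  refine forall₂_congr fun c _ => ?_
  simp [mul_smul]

/-- The stabilizer of a point is a subgroup, so it contains `g` exactly when it contains `⟨g⟩`. -/
theorem leftMark_zpowers (g : H) (X : Biset p H G) :
    leftMark (Subgroup.zpowers g) X = Nat.card (MulAction.fixedBy X.carrier g) := by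
  refine Nat.card_congr (Equiv.subtypeEquivRight fun x => ?_)
  exact Subgroup.zpowers_le (H := MulAction.stabilizer H x)

theorem rightMark_zpowers (g : G) (X : Biset p H G) :
    rightMark (Subgroup.zpowers g) X = Nat.card (MulAction.fixedBy X.carrier (op g)) := by
  refine Nat.card_congr (Equiv.subtypeEquivRight fun x => ?_)
  exact Subgroup.zpowers_le (H := (MulAction.stabilizer Gᵐᵒᵖ x).unop)

/-- This is where the stabilizer condition enters: a subgroup with a fixed point lies in a
stabilizer, so its order divides a number prime to `p`. -/
theorem leftMark_eq_zero (C : Subgroup H) (hC : ¬ IsPPrimeGroup p C) (X : Biset p H G) :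
    leftMark C X = 0 := by
  have : IsEmpty {x : X.carrier // ∀ c ∈ C, c • x = x} :=
    ⟨fun x => hC ((X.left_stabilizer x.1).coprime_dvd_left
      (Subgroup.card_dvd_of_le (show C ≤ MulAction.stabilizer H x.1 from x.2)))⟩
  exact Nat.card_of_isEmpty

end Marks

/-! ### Counting the elements of `Y ×_G X` as orbits -/

section Orbits

variable {p : ℕ} {G : Type u} [Group G]

/-- The Cauchy-Frobenius formula for the number of elements of `Y ×_G X`. -/
theorem card_comp_mul_card [Finite G] [Fintype G] (Y : Biset p Triv.{u} G)
    (X : Biset p G Triv.{u}) :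
    Nat.card (Y.comp X).carrier * Nat.card G =
      ∑ g : G, rightMark (Subgroup.zpowers g) Y * leftMark (Subgroup.zpowers g) X := by
  classical
  -- With the right action turned into a left one by inversion, the relation `(y h, x) ∼ (y, h x)`
  -- becomes the orbit relation of the diagonal action on `Y × X`.
  let _ : MulAction G Y.carrier := MulAction.compHom Y.carrier (MulEquiv.inv' G).toMonoidHom
  have hsmul (g : G) (y : Y.carrier) : g • y = op g⁻¹ • y := rfl
  have hcomp : Nat.card (Y.comp X).carrier =
      Nat.card (Quotient (MulAction.orbitRel G (Y.carrier × X.carrier))) := by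
    refine Nat.card_congr (Quotient.congr (Equiv.refl _) ?_)
    rintro ⟨y, x⟩ ⟨y', x'⟩
    change (∃ h : G, y' = op h • y ∧ x = h • x') ↔ (y, x) ∈ MulAction.orbit G (y', x')
    refine exists_congr fun h => ?_
    change _ ↔ (h • y', h • x') = (y, x)
    rw [Prod.mk.injEq, hsmul, MulOpposite.op_inv, inv_smul_eq_iff, eq_comm (a := x)]
  have := Fintype.ofFinite X.carrier
  have := Fintype.ofFinite Y.carrier
  have hB := MulAction.sum_card_fixedBy_eq_card_orbits_mul_card_group G (Y.carrier × X.carrier)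
  rw [hcomp, Nat.card_eq_fintype_card, Nat.card_eq_fintype_card, ← hB]
  refine Finset.sum_congr rfl fun g _ => ?_
  rw [leftMark_zpowers, rightMark_zpowers, ← Nat.card_eq_fintype_card, ← Nat.card_prod]
  refine Nat.card_congr ((Equiv.subtypeEquivRight fun a => ?_).trans
    (Equiv.subtypeProdEquivProd (p := fun y : Y.carrier => op g • y = y)
      (q := fun x : X.carrier => g • x = x)))
  rw [MulAction.mem_fixedBy, Prod.ext_iff, Prod.smul_fst, Prod.smul_snd, hsmul, MulOpposite.op_inv,
    inv_smul_eq_iff, eq_comm (a := a.1)]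

end Orbits

/-! ### Transitive bisets `G / D` and their marks -/

section Transitive

variable {p : ℕ} {G : Type u} [Group G]

theorem isPPrimeGroup_of_subsingleton (p : ℕ) (A : Type*) [Group A] [Subsingleton A] :
    IsPPrimeGroup p A := by
  rw [IsPPrimeGroup, Nat.card_unique]
  exact Nat.coprime_one_left p

/-- A `G`-set with `p'`-stabilizers as a `(G, 1)`-biset. -/
def Biset.ofLeft (Ω : Type u) [Finite Ω] [MulAction G Ω]
    (h : ∀ x : Ω, IsPPrimeGroup p (MulAction.stabilizer G x)) : Biset p G Triv.{u} where
  carrier := Ω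
  right := { smul := fun _ x => x, one_smul := fun _ => rfl, mul_smul := fun _ _ _ => rfl }
  comm := @SMulCommClass.mk _ _ _ _ ⟨fun _ x => x⟩ fun _ _ _ => rfl
  left_stabilizer := h
  right_stabilizer _ := isPPrimeGroup_of_subsingleton p _

/-- A `G`-set with `p'`-stabilizers as a `(1, G)`-biset, with `x g = g⁻¹ x`. -/
def Biset.ofRight (Ω : Type u) [Finite Ω] [MulAction G Ω]
    (h : ∀ x : Ω, IsPPrimeGroup p (MulAction.stabilizer G x)) : Biset p Triv.{u} G where
  carrier := Ω
  left := { smul := fun _ x => x, one_smul := fun _ => rfl, mul_smul := fun _ _ _ => rfl }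
  right := MulAction.compHom Ω (MulEquiv.inv' G).symm.toMonoidHom
  comm := @SMulCommClass.mk _ _ _ ⟨fun _ x => x⟩
    (MulAction.compHom Ω (MulEquiv.inv' G).symm.toMonoidHom).toSMul fun _ _ _ => rfl
  left_stabilizer _ := isPPrimeGroup_of_subsingleton p _
  right_stabilizer x := by
    let _ : MulAction Gᵐᵒᵖ Ω := MulAction.compHom Ω (MulEquiv.inv' G).symm.toMonoidHom
    -- Inversion carries the right stabilizer bijectively onto the left one.
    have : Nat.card (MulAction.stabilizer Gᵐᵒᵖ x) = Nat.card (MulAction.stabilizer G x) :=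
      Nat.card_congr ((MulEquiv.inv' G).symm.toEquiv.subtypeEquiv fun _ => Iff.rfl)
    exact (congrArg (fun n => n.Coprime p) this).mpr (h x)

/-- An element and its inverse have the same fixed points. This transfers the table of marks from
`(G, 1)`-bisets to `(1, G)`-bisets. -/
theorem rightMark_ofRight (Ω : Type u) [Finite Ω] [MulAction G Ω]
    (h : ∀ x : Ω, IsPPrimeGroup p (MulAction.stabilizer G x)) (C : Subgroup G) :
    rightMark C (Biset.ofRight Ω h) = leftMark C (Biset.ofLeft Ω h) := by
  refine Nat.card_congr (Equiv.subtypeEquivRight fun x => ?_)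
  let y : Ω := x
  change (∀ c ∈ C, c⁻¹ • y = y) ↔ ∀ c ∈ C, c • y = y
  exact forall₂_congr fun c _ => inv_smul_eq_iff.trans eq_comm

/-- The stabilizer of the coset `gD` is `gDg⁻¹`, which has the order of `D`. -/
theorem isPPrimeGroup_stabilizer_quotient {D : Subgroup G} (hD : IsPPrimeGroup p D) (x : G ⧸ D) :
    IsPPrimeGroup p (MulAction.stabilizer G x) := by
  obtain ⟨g, rfl⟩ := QuotientGroup.mk_surjective x
  have h1 := MulAction.stabilizer_smul_eq_stabilizer_map_conj g ((1 : G) : G ⧸ D)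
  rw [MulAction.stabilizer_quotient, MulAction.Quotient.smul_coe, smul_eq_mul, mul_one] at h1
  rw [h1, IsPPrimeGroup, Subgroup.card_map_of_injective (MulAut.conj g).injective]
  exact hD

variable [Finite G]

/-- The transitive `G`-set `G / D`, as a `(G, 1)`-biset. -/
def Biset.quotient (D : Subgroup G) (hD : IsPPrimeGroup p D) : Biset p G Triv.{u} :=
  Biset.ofLeft (G ⧸ D) (isPPrimeGroup_stabilizer_quotient hD)

/-- The trivial coset is fixed by `D`. This is the diagonal entry of the table of marks. -/
theorem leftMark_quotient_self_ne_zero (D : Subgroup G) (hD : IsPPrimeGroup p D) :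
    leftMark D (Biset.quotient D hD) ≠ 0 := by
  have : Nonempty {x : (Biset.quotient D hD).carrier // ∀ c ∈ D, c • x = x} :=
    ⟨((1 : G) : G ⧸ D), fun c hc => by
      change c • ((1 : G) : G ⧸ D) = _
      rw [← MulAction.mem_stabilizer_iff, MulAction.stabilizer_quotient]
      exact hc⟩
  exact Nat.card_pos.ne'

/-- If `C` fixes `gD`, then `C` lies in the stabilizer `gDg⁻¹`. This is the source of the
triangularity of the table of marks. -/
theorem exists_le_map_conj_of_leftMark_quotient_ne_zero (C D : Subgroup G)
    (hD : IsPPrimeGroup p D) (h : leftMark C (Biset.quotient D hD) ≠ 0) :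
    ∃ g : G, C ≤ D.map (MulAut.conj g).toMonoidHom := by
  obtain ⟨⟨x, hx⟩⟩ := (Nat.card_ne_zero.mp h).1
  obtain ⟨g, rfl⟩ := QuotientGroup.mk_surjective (s := D) x
  refine ⟨g, ?_⟩
  have h1 := MulAction.stabilizer_smul_eq_stabilizer_map_conj g ((1 : G) : G ⧸ D)
  rw [MulAction.stabilizer_quotient, MulAction.Quotient.smul_coe, smul_eq_mul, mul_one] at h1
  rw [← h1]
  exact hx

end Transitive

/-! ### Marks at the classes of cyclic `p'`-subgroups, and the diagonal form -/

section Classes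

variable {p : ℕ} {G : Type u} [Group G]

theorem leftMark_out (C : CyclicPPrimeSubgroup p G) (X : Biset p G Triv.{u}) :
    leftMark (Quotient.mk (conjSetoid p G) C).out.1 X = leftMark C.1 X := by
  obtain ⟨g, hg⟩ := Quotient.mk_out (s := conjSetoid p G) C
  rw [hg, leftMark_map_conj]

theorem rightMark_out (C : CyclicPPrimeSubgroup p G) (X : Biset p Triv.{u} G) :
    rightMark (Quotient.mk (conjSetoid p G) C).out.1 X = rightMark C.1 X := by
  obtain ⟨g, hg⟩ := Quotient.mk_out (s := conjSetoid p G) C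
  rw [hg, rightMark_map_conj]

variable [Finite G]

/-- One representative lies in a conjugate of the other; if its order were not smaller, the two
would be conjugate and the classes equal. -/
theorem card_out_lt_of_leftMark_quotient_ne_zero {q r : Quotient (conjSetoid p G)} (hr : r ≠ q)
    (h : leftMark r.out.1 (Biset.quotient q.out.1 q.out.2.2) ≠ 0) :
    Nat.card r.out.1 < Nat.card q.out.1 := by
  obtain ⟨g, hg⟩ := exists_le_map_conj_of_leftMark_quotient_ne_zero _ _ _ h
  have hcard : Nat.card (q.out.1.map (MulAut.conj g).toMonoidHom) = Nat.card q.out.1 :=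
    Subgroup.card_map_of_injective (MulAut.conj g).injective
  by_contra hlt
  have heq := Subgroup.eq_of_le_of_card_ge hg (hcard.trans_le (not_lt.mp hlt))
  apply hr
  rw [← r.out_eq, ← q.out_eq]
  exact (Quotient.sound (s := conjSetoid p G) ⟨g, heq⟩).symm

variable (𝕂 : Type v) [Field 𝕂]

/-- The table of marks at the cyclic `p'`-subgroups is invertible: a submodule containing the mark
vectors of all `G / D` is everything. -/
theorem eq_top_of_forall_leftMark_mem [CharZero 𝕂]
    (W : Submodule 𝕂 (Quotient (conjSetoid p G) → 𝕂))
    (hW : ∀ q : Quotient (conjSetoid p G),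
      (fun r : Quotient (conjSetoid p G) =>
        (leftMark r.out.1 (Biset.quotient q.out.1 q.out.2.2) : 𝕂)) ∈ W) : W = ⊤ := by
  classical
  have := Fintype.ofFinite (Quotient (conjSetoid p G))
  -- Induction on the order of the representative: the mark vector of `G / D` is a nonzero multiple
  -- of the unit vector at the class of `D` plus unit vectors at classes of smaller order, already
  -- known to lie in `W`.
  have key : ∀ (n : ℕ) (q : Quotient (conjSetoid p G)), Nat.card q.out.1 = n →
      (Pi.single q 1 : Quotient (conjSetoid p G) → 𝕂) ∈ W := by
    intro n
    induction n using Nat.strong_induction_on with | _ n ih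
    rintro q rfl
    have hq := hW q
    set f : Quotient (conjSetoid p G) → 𝕂 := fun r =>
      (leftMark r.out.1 (Biset.quotient q.out.1 q.out.2.2) : 𝕂) with hf
    have hsum : f = f q • Pi.single q 1 +
        ∑ r ∈ Finset.univ.erase q, f r • (Pi.single r 1 : Quotient (conjSetoid p G) → 𝕂) := by
      rw [Finset.add_sum_erase _ (fun r => f r • (Pi.single r 1 : _ → 𝕂)) (Finset.mem_univ q)]
      exact pi_eq_sum_univ' f |>.trans (by simp)
    have hrest : ∑ r ∈ Finset.univ.erase q,
        f r • (Pi.single r 1 : Quotient (conjSetoid p G) → 𝕂) ∈ W := by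
      refine Submodule.sum_mem _ fun r hr => ?_
      by_cases h0 : leftMark r.out.1 (Biset.quotient q.out.1 q.out.2.2) = 0
      · have : f r = 0 := by simp [hf, h0]
        rw [this, zero_smul]
        exact W.zero_mem
      · exact W.smul_mem _ (ih _ (card_out_lt_of_leftMark_quotient_ne_zero
          (Finset.ne_of_mem_erase hr) h0) r rfl)
    have hfq : f q ≠ 0 := Nat.cast_ne_zero.mpr (leftMark_quotient_self_ne_zero _ _)
    rw [hsum, W.add_mem_iff_left hrest] at hq
    exact (W.smul_mem_iff hfq).mp hq
  rw [eq_top_iff, ← (Pi.basisFun 𝕂 (Quotient (conjSetoid p G))).span_eq, Submodule.span_le]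
  rintro _ ⟨q, rfl⟩
  simpa using key _ q rfl

/-- The marks of `(G, 1)`-bisets at the classes of cyclic `p'`-subgroups. -/
def leftMarks (p : ℕ) (G : Type u) [Group G] :
    RB p 𝕂 G Triv.{u} →ₗ[𝕂] Quotient (conjSetoid p G) → 𝕂 :=
  LinearMap.pi fun q => leftMarkLinear 𝕂 q.out.1

/-- The marks of `(1, G)`-bisets at the classes of cyclic `p'`-subgroups. -/
def rightMarks (p : ℕ) (G : Type u) [Group G] :
    RB p 𝕂 Triv.{u} G →ₗ[𝕂] Quotient (conjSetoid p G) → 𝕂 :=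
  LinearMap.pi fun q => rightMarkLinear 𝕂 q.out.1

theorem leftMarks_surjective [CharZero 𝕂] : Function.Surjective (leftMarks 𝕂 p G) := by
  rw [← LinearMap.range_eq_top]
  refine eq_top_of_forall_leftMark_mem 𝕂 _ fun q =>
    ⟨1 ⊗ₜ (Biset.quotient q.out.1 q.out.2.2).cls, funext fun r => leftMarkLinear_cls 𝕂 _ _⟩

theorem rightMarks_surjective [CharZero 𝕂] : Function.Surjective (rightMarks 𝕂 p G) := by
  rw [← LinearMap.range_eq_top]
  refine eq_top_of_forall_leftMark_mem 𝕂 _ fun q =>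
    ⟨1 ⊗ₜ (Biset.ofRight (G ⧸ q.out.1) (isPPrimeGroup_stabilizer_quotient q.out.2.2)).cls,
      funext fun r => (rightMarkLinear_cls 𝕂 _ _).trans ?_⟩
  rw [rightMark_ofRight]
  rfl

/-- The number of generators of subgroups in a class of cyclic `p'`-subgroups. -/
def generatorCount (q : Quotient (conjSetoid p G)) : ℕ :=
  Nat.card {g : {g : G // IsPPrimeGroup p (Subgroup.zpowers g)} //
    Quotient.mk (conjSetoid p G) ⟨Subgroup.zpowers g.1, inferInstance, g.2⟩ = q}

theorem generatorCount_ne_zero (q : Quotient (conjSetoid p G)) : generatorCount q ≠ 0 := by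
  induction q using Quotient.inductionOn with | _ C
  obtain ⟨C, hC, hp⟩ := C
  obtain ⟨g, rfl⟩ := (Subgroup.isCyclic_iff_exists_zpowers_eq_top C).mp hC
  exact Nat.card_ne_zero.mpr ⟨⟨⟨⟨g, hp⟩, rfl⟩⟩, inferInstance⟩

/-- The Cauchy-Frobenius sum is split along the fibres of `g ↦ [⟨g⟩]`; on each fibre the summand is
constant by conjugation invariance. -/
theorem card_comp_mul_card_eq_sum_classes [Fintype (Quotient (conjSetoid p G))]
    (Y : Biset p Triv.{u} G) (X : Biset p G Triv.{u}) :
    Nat.card (Y.comp X).carrier * Nat.card G =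
      ∑ q : Quotient (conjSetoid p G),
        generatorCount q * (rightMark q.out.1 Y * leftMark q.out.1 X) := by
  classical
  have := Fintype.ofFinite G
  let κ : {g : G // IsPPrimeGroup p (Subgroup.zpowers g)} → Quotient (conjSetoid p G) :=
    fun g => Quotient.mk _ ⟨Subgroup.zpowers g.1, inferInstance, g.2⟩
  -- Elements not generating a `p'`-group have no fixed points on `X`; one vanishing factor is
  -- enough.
  have hsum : ∑ g : G, rightMark (Subgroup.zpowers g) Y * leftMark (Subgroup.zpowers g) X =
      ∑ g : {g : G // IsPPrimeGroup p (Subgroup.zpowers g)},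
        rightMark (Subgroup.zpowers g.1) Y * leftMark (Subgroup.zpowers g.1) X := by
    rw [← Finset.sum_subtype (Finset.univ.filter fun g => IsPPrimeGroup p (Subgroup.zpowers g))
      (by simp) (fun g => rightMark (Subgroup.zpowers g) Y * leftMark (Subgroup.zpowers g) X)]
    refine (Finset.sum_filter_of_ne fun g _ hg => ?_).symm
    by_contra hC
    exact hg (by rw [leftMark_eq_zero _ hC, mul_zero])
  rw [card_comp_mul_card, hsum, ← Fintype.sum_fiberwise κ]
  refine Finset.sum_congr rfl fun q _ => ?_
  have hterm (g : {g // κ g = q}) :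
      rightMark (Subgroup.zpowers g.1.1) Y * leftMark (Subgroup.zpowers g.1.1) X =
        rightMark q.out.1 Y * leftMark q.out.1 X := by
    obtain ⟨g, rfl⟩ := g
    rw [rightMark_out, leftMark_out]
  rw [Finset.sum_congr rfl fun g _ => hterm g, Finset.sum_const, smul_eq_mul, Finset.card_univ,
    ← Nat.card_eq_fintype_card]
  rfl

/-- Both sides are bilinear, so the identity for classes of bisets extends to the scalar extensions.
-/
theorem augLinear_comp_mul_card [Fintype (Quotient (conjSetoid p G))]
    (y : RB p 𝕂 Triv.{u} G) (x : RB p 𝕂 G Triv.{u}) :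
    augLinear p 𝕂 (RB.comp p 𝕂 _ _ _ y x) * Nat.card G =
      ∑ q : Quotient (conjSetoid p G),
        generatorCount q * (rightMarks 𝕂 p G y q * leftMarks 𝕂 p G x q) := by
  induction y using RB.induction with
  | zero => simp
  | add a b ha hb =>
    simp only [map_add, LinearMap.add_apply, add_mul, mul_add, Pi.add_apply,
      Finset.sum_add_distrib, ha, hb]
  | smul r a ha =>
    simp only [map_smul, LinearMap.smul_apply, smul_eq_mul, Pi.smul_apply, mul_assoc, ha,
      Finset.mul_sum]
    exact Finset.sum_congr rfl fun q _ => by ring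
  | cls Y =>
    induction x using RB.induction with
    | zero => simp
    | add a b ha hb =>
      simp only [map_add, add_mul, mul_add, Pi.add_apply, Finset.sum_add_distrib, ha, hb]
    | smul r a ha =>
      simp only [map_smul, smul_eq_mul, Pi.smul_apply, mul_assoc, ha, Finset.mul_sum]
      exact Finset.sum_congr rfl fun q _ => by ring
    | cls X =>
      rw [RB.comp_cls, augLinear_cls, ← Nat.cast_mul, card_comp_mul_card_eq_sum_classes]
      simp only [leftMarks, rightMarks, LinearMap.pi_apply, leftMarkLinear_cls,
        rightMarkLinear_cls]
      push_cast
      rfl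

/-- The evaluation of `S_{1,𝕂}` at `G` has coordinates given by the marks at the classes of cyclic
`p'`-subgroups. -/
theorem nonempty_sTrivial_equiv [CharZero 𝕂] :
    Nonempty ((L (trivialModule.{u, v} p 𝕂) ⟨G⟩ ⧸ J (trivialModule.{u, v} p 𝕂) ⟨G⟩) ≃ₗ[𝕂]
      (Quotient (conjSetoid p G) → 𝕂)) := by
  have := Fintype.ofFinite (Quotient (conjSetoid p G))
  have hG : (Nat.card G : 𝕂) ≠ 0 := Nat.cast_ne_zero.mpr Nat.card_pos.ne'
  -- The coordinates live on the tensor product over `𝕂`, before the balancing relations are divided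
  -- out, so `L` itself need not be computed.
  refine nonempty_quotient_equiv_of_diagonal (Submodule.mkQ _) (Submodule.mkQ_surjective _)
    (leftMarks 𝕂 p G ∘ₗ (TensorProduct.rid 𝕂 (RB p 𝕂 G Triv.{u})).toLinearMap)
    ((leftMarks_surjective 𝕂).comp (TensorProduct.rid 𝕂 _).surjective)
    (rightMarks 𝕂 p G) (rightMarks_surjective 𝕂)
    (fun q => (generatorCount q : 𝕂) / Nat.card G)
    (fun q => div_ne_zero (Nat.cast_ne_zero.mpr (generatorCount_ne_zero q)) hG)
    (L.eval (trivialModule.{u, v} p 𝕂) (H := ⟨G⟩)) fun y t => ?_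
  induction t using TensorProduct.induction_on with
  | zero => simp
  | add a b ha hb => simp only [map_add, ha, hb, Pi.add_apply, mul_add, Finset.sum_add_distrib]
  | tmul x v =>
    have h := augLinear_comp_mul_card 𝕂 (p := p) (G := G) y x
    -- `E_1` acts on `𝕂` through `aug`, and `TensorProduct.rid` sends `x ⊗ v` to `v • x`.
    change augLinear p 𝕂 (RB.comp p 𝕂 _ _ _ y x) * v = ∑ q, _ * (_ * leftMarks 𝕂 p G (v • x) q)
    rw [eq_div_of_mul_eq hG h, Finset.sum_div, Finset.sum_mul]
    refine Finset.sum_congr rfl fun q _ => ?_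
    rw [map_smul, Pi.smul_apply, smul_eq_mul]
    ring

end Classes

end PBifree

end

/-- The dimension of the evaluation at `G` of the simple `p`-bifree biset functor attached to the
trivial group and the trivial module is the number of conjugacy classes of cyclic `p'`-subgroups
of `G`. -/
theorem mainTheorem4 (p : ℕ) (hp : p.Prime) (𝕂 : Type v) [Field 𝕂] [CharZero 𝕂]
    (G : Type u) [Group G] [Finite G] :
    Module.Finite 𝕂 ((PBifree.STrivial.{u, v} p 𝕂).obj ⟨G⟩) ∧
      Module.finrank 𝕂 ((PBifree.STrivial.{u, v} p 𝕂).obj ⟨G⟩) =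
        Nat.card (Quotient (PBifree.conjSetoid p G)) := by
  obtain ⟨e⟩ := PBifree.nonempty_sTrivial_equiv (p := p) (G := G) 𝕂
  have := Fintype.ofFinite (Quotient (PBifree.conjSetoid p G))
  refine ⟨Module.Finite.equiv e.symm, (LinearEquiv.finrank_eq e).trans ?_⟩
  rw [Module.finrank_fintype_fun_eq_card, Nat.card_eq_fintype_card]
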